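/- Let $\Phi$ be a stationary (simple, locally finite) point process on $\mathbb{R}^2$, defined on a probability space $(\Omega,\mathcal A,\mathbb P)$. A stationary marking of $\Phi$ with $K$ marks assigns to each point $x\in\Phi$ a mark $M(x)\in\{1,\dots,K\}$ in such a way that the law of the marked point process $\{(x,M(x)):x\in\Phi\}$ is invariant under translations of the points (each point keeping its mark). For an integer $K\ge 1$ and a real $H_K>0$, $\Phi$ is called $(K,H_K)$-hardcore regulated if it has a stationary marking with $K$ marks such that, almost surely, $\|x-y\|\ge 2H_K$ for all distinct $x,y\in\Phi$ with $M(x)=M(y)$. A stationary point process $\Psi$ on $\mathbb{R}^2$ is called strongly $(\sigma,\rho,\nu)$-ball regulated ($\sigma,\nu>0$) if for every $R\ge 0$, almost surely, the number of points of $\Psi$ in the open ball $b(o,R)$ of radius $R$ centred at the origin is at most $\sigma+\rho R+\nu R^2$. For $H>0$ put $$\rho_H=\frac{2\pi}{\sqrt{12}\,H},\qquad \nu_H=\frac{\pi}{\sqrt{12}\,H^2}.$$ If $\Phi$ is $(K,H_K)$-hardcore regulated, then there exists a stationary marking $M$ of $\Phi$ with $K$ marks such that for every $i\in\{1,\dots,K\}$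 the point process $\{x\in\Phi: M(x)=i\}$ is strongly $(1,\rho_{H_K},\nu_{H_K})$-ball regulated; further, for every $i\in\{1,\dots,K\}$, every non-negative, bounded, non-increasing function $\ell:[0,\infty)\to[0,\infty)$ and every $R>0$, almost surely, $$\sum_{x\in\Phi\cap b(o,R),\,M(x)=i}\ell(\|x\|)\;\le\;\ell(0)+\rho_{H_K}\int_0^R\ell(r)\,\mathrm dr+2\nu_{H_K}\int_0^R r\,\ell(r)\,\mathrm dr .$$ -/

import Mathlib

open MeasureTheory ProbabilityTheory Set

noncomputable section

namespace Hardcore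

/-- The Euclidean plane. -/
abbrev Plane : Type := EuclideanSpace ℝ (Fin 2)

/-- The counting measure `∑_{x ∈ S} δ_x` of a set of points `S`. -/
def pointMeasure {X : Type*} [MeasurableSpace X] (S : Set X) : Measure X :=
  Measure.sum (fun x : S => Measure.dirac (x : X))

/-- A (simple) point process on the plane: a random locally finite set of points whose counting
measure is a measurable function of `ω` (equivalently, the number of points in every Borel set is a
random variable). -/
structure IsPointProcess {Ω : Type*} [MeasurableSpace Ω] (Φ : Ω → Set Plane) : Prop where
  locallyFinite : ∀ ω, ∀ B : Set Plane, Bornology.IsBounded B → (Φ ω ∩ B).Finite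
  measurable : Measurable (fun ω => pointMeasure (Φ ω))

/-- A stationary point process: the law is invariant under all translations. -/
structure IsStationaryPointProcess {Ω : Type*} [MeasurableSpace Ω] (P : Measure Ω)
    (Φ : Ω → Set Plane) : Prop extends IsPointProcess Φ where
  stationary : ∀ t : Plane,
    P.map (fun ω => pointMeasure ((fun x => x + t) '' Φ ω)) = P.map (fun ω => pointMeasure (Φ ω))

/-- The marked configuration `{(x, M(x)) : x ∈ S}`. -/
def markedPoints {K : ℕ} (S : Set Plane) (M : Plane → Fin K) : Set (Plane × Fin K) :=
  (fun x => (x, M x)) '' S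

/-- `M` is a stationary marking of the point process `Φ` by `K` marks: the marked points
`(x, M(x))`, `x ∈ Φ`, form a random (measurable) marked configuration whose law is invariant when
all points are translated and every point keeps its mark. Only the values of `M ω` at the points of
`Φ ω` play a role. -/
structure IsStationaryMarking {Ω : Type*} [MeasurableSpace Ω] (P : Measure Ω)
    (Φ : Ω → Set Plane) {K : ℕ} (M : Ω → Plane → Fin K) : Prop where
  measurable : Measurable (fun ω => pointMeasure (markedPoints (Φ ω) (M ω)))
  stationary : ∀ t : Plane,
    P.map (fun ω => pointMeasure
      ((fun p : Plane × Fin K => (p.1 + t, p.2)) '' markedPoints (Φ ω) (M ω))) =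
    P.map (fun ω => pointMeasure (markedPoints (Φ ω) (M ω)))

/-- The class `{x ∈ Φ : M(x) = i}`. -/
def markClass {Ω : Type*} (Φ : Ω → Set Plane) {K : ℕ} (M : Ω → Plane → Fin K) (i : Fin K) :
    Ω → Set Plane :=
  fun ω => {x ∈ Φ ω | M ω x = i}

/-- `(K, H)`-hardcore regulation: some stationary marking by `K` marks is such that, almost surely,
any two distinct points with the same mark are at distance at least `2H`. -/
structure IsHardcoreRegulated {Ω : Type*} [MeasurableSpace Ω] (P : Measure Ω)
    (Φ : Ω → Set Plane) (K : ℕ) (H : ℝ) : Prop extends IsStationaryPointProcess P Φ where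
  exists_marking : ∃ M : Ω → Plane → Fin K, IsStationaryMarking P Φ M ∧
    ∀ᵐ ω ∂P, ∀ x ∈ Φ ω, ∀ y ∈ Φ ω, x ≠ y → M ω x = M ω y → 2 * H ≤ ‖x - y‖

/-- Strong `(σ, ρ, ν)`-ball regulation of a stationary point process: for every `R ≥ 0`, almost
surely, the open ball of radius `R` around the origin holds at most `σ + ρ R + ν R²` points. -/
structure IsStronglyBallRegulated {Ω : Type*} [MeasurableSpace Ω] (P : Measure Ω)
    (Φ : Ω → Set Plane) (σ ρ ν : ℝ) : Prop extends IsStationaryPointProcess P Φ where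
  sigma_pos : 0 < σ
  nu_pos : 0 < ν
  bound : ∀ R : ℝ, 0 ≤ R →
    ∀ᵐ ω ∂P, ((Φ ω ∩ Metric.ball (0 : Plane) R).ncard : ℝ) ≤ σ + ρ * R + ν * R ^ 2

/-- `ρ_H = 2π / (√12 H)`. -/
def rhoH (H : ℝ) : ℝ := 2 * Real.pi / (Real.sqrt 12 * H)

/-- `ν_H = π / (√12 H²)`. -/
def nuH (H : ℝ) : ℝ := Real.pi / (Real.sqrt 12 * H ^ 2)

end Hardcore

end

noncomputable section

namespace Hardcore

/-! The marking given by the hardcore assumption already works. Outside one null event each of its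
classes has mutual distances at least `2 * H`, so both bounds are deterministic facts about
separated sets; probability enters only in the stationarity of a class.

The count is a packing bound, `card_le_of_separated`. Scale to H = 1, write r for `cellRadius`, and
truncate the Voronoi cells at distance r from their points and by the disc of squared radius A = R²
+ 2R + 1.1. The cells are disjoint and each has area at least 3r = √12 (`volume_cell_ge`). Hence n
√12 ≤ π A, and the constant term 1.1 π / √12 is below 1.

For the area of a cell, the disc of radius r loses a segment to each bisector and a cap to the outer
boundary. Each loss is charged to a sector of the disc, with area ratio at most `capRatio`
(`volume_bisectorCap_le`, `volume_outerCap_le`). These sectors are disjoint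
(`disjoint_bisectorSector`, `disjoint_outerSector`), so the total loss is at most that of the
inscribed regular hexagon.

For sums (`sum_le_of_card_le`), let N(t) = 1 + ρ t + ν t² and N(b_n) = n. The n-th nearest point has
norm at least b_n, so for n ≥ 2 its term is at most the integral of ℓ dN over [b_{n-1}, b_n]; the
nearest point costs at most ℓ(0). -/

/-! ### Areas of sectors and circular segments. -/

/-- An isometry of the complex plane onto `Plane` mapping `1` to a given unit vector. -/
lemma exists_isometry_re_eq_inner (u : Plane) (hu : ‖u‖ = 1) :
    ∃ L : ℂ ≃ₗᵢ[ℝ] Plane, ∀ z, inner ℝ (L z) u = z.re := by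
  let L₀ : ℂ ≃ₗᵢ[ℝ] Plane := Complex.orthonormalBasisOneI.repr
  have hw : ‖L₀.symm u‖ = 1 := by rw [L₀.symm.norm_map, hu]
  let w : Circle := ⟨L₀.symm u, by simpa [Submonoid.unitSphere] using hw⟩
  refine ⟨(rotation w).trans L₀, fun z => ?_⟩
  have h1 : inner ℝ (((rotation w).trans L₀) z) u = inner ℝ ((w : ℂ) * z) (w : ℂ) := by
    have h2 : L₀ (w : ℂ) = u := L₀.apply_symm_apply u
    rw [← L₀.inner_map_map ((w : ℂ) * z), h2]
    rfl
  rw [h1, Complex.inner]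
  have h2 : ((w : ℂ).re) ^ 2 + (w : ℂ).im ^ 2 = 1 := by
    have := Circle.normSq_coe w
    rw [Complex.normSq_apply] at this
    nlinarith
  simp only [map_mul, Complex.mul_re, Complex.mul_im, Complex.conj_re, Complex.conj_im]
  linear_combination z.re * h2

/-- Integration in polar coordinates. The chart omits the negative real axis, a null set, so
membership in `S` is tested only at angles strictly between -π and π. -/
lemma volume_eq_of_polar {S : Set ℂ} (hS : MeasurableSet S) {I : Set ℝ} (hI : MeasurableSet I)
    (hIπ : I ⊆ Ioo (-Real.pi) Real.pi) {r : ℝ} (hr : 0 ≤ r)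
    (h : ∀ ρ φ : ℝ, 0 < ρ → φ ∈ Ioo (-Real.pi) Real.pi →
      (Complex.polarCoord.symm (ρ, φ) ∈ S ↔ ρ < r ∧ φ ∈ I)) :
    volume S = ENNReal.ofReal (r ^ 2 / 2) * volume I := by
  rw [← lintegral_indicator_one hS, ← Complex.lintegral_comp_polarCoord_symm]
  have h1 : ∫⁻ p in polarCoord.target,
      ENNReal.ofReal p.1 • S.indicator (1 : ℂ → ENNReal) (Complex.polarCoord.symm p)
      = ∫⁻ p in polarCoord.target, (Ioo 0 r ×ˢ I).indicator (fun p => ENNReal.ofReal p.1) p := by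
    refine setLIntegral_congr_fun polarCoord.open_target.measurableSet ?_
    rintro ⟨ρ, φ⟩ hp
    rw [polarCoord_target] at hp
    have hp1 : 0 < ρ := hp.1
    have := h ρ φ hp1 hp.2
    by_cases hm : ρ < r ∧ φ ∈ I
    · have h2 : Complex.polarCoord.symm (ρ, φ) ∈ S := this.2 hm
      have h3 : (ρ, φ) ∈ Ioo 0 r ×ˢ I := ⟨⟨hp1, hm.1⟩, hm.2⟩
      simp only [indicator_of_mem h2, indicator_of_mem h3]
      simp
    · have h2 : Complex.polarCoord.symm (ρ, φ) ∉ S := fun hh => hm (this.1 hh)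
      have h3 : (ρ, φ) ∉ Ioo 0 r ×ˢ I := fun hh => hm ⟨hh.1.2, hh.2⟩
      simp only [indicator_of_notMem h2, indicator_of_notMem h3]
      simp
  rw [h1, setLIntegral_indicator (measurableSet_Ioo.prod hI)]
  have h2 : Ioo 0 r ×ˢ I ∩ polarCoord.target = Ioo 0 r ×ˢ I := by
    rw [inter_eq_left, polarCoord_target]
    exact prod_mono (fun x hx => hx.1) hIπ
  rw [h2, Measure.volume_eq_prod, ← Measure.prod_restrict,
    lintegral_prod _ (by fun_prop)]
  simp only [lintegral_const, Measure.restrict_apply MeasurableSet.univ, univ_inter]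
  rw [lintegral_mul_const _ (by fun_prop)]
  congr 1
  rw [← ofReal_integral_eq_lintegral_ofReal, ← integral_Ioc_eq_integral_Ioo,
    ← intervalIntegral.integral_of_le hr, integral_id]
  · simp
  · exact (continuous_id.integrableOn_Icc (a := 0) (b := r)).mono_set Ioo_subset_Icc_self
  · exact (ae_restrict_mem measurableSet_Ioo).mono fun x hx => hx.1.le

lemma polarCoord_symm_norm_re {ρ φ : ℝ} (hρ : 0 < ρ) :
    ‖Complex.polarCoord.symm (ρ, φ)‖ = ρ ∧
      (Complex.polarCoord.symm (ρ, φ)).re = ρ * Real.cos φ := by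
  constructor
  · rw [Complex.norm_polarCoord_symm, abs_of_pos hρ]
  · rw [Complex.polarCoord_symm_apply]
    simp [Complex.cos_ofReal_re]

lemma cos_lt_cos_iff_abs_lt {ψ φ : ℝ} (hψ : 0 ≤ ψ) (hψ' : ψ ≤ Real.pi)
    (hφ : φ ∈ Ioo (-Real.pi) Real.pi) : Real.cos ψ < Real.cos φ ↔ |φ| < ψ := by
  rw [← Real.cos_abs φ]
  exact Real.strictAntiOn_cos.lt_iff_gt ⟨hψ, hψ'⟩ ⟨abs_nonneg _, (abs_lt.2 hφ).le⟩

lemma cos_le_cos_iff_abs_le {ψ φ : ℝ} (hψ : 0 ≤ ψ) (hψ' : ψ ≤ Real.pi)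
    (hφ : φ ∈ Ioo (-Real.pi) Real.pi) : Real.cos ψ ≤ Real.cos φ ↔ |φ| ≤ ψ := by
  rw [← Real.cos_abs φ]
  exact Real.strictAntiOn_cos.le_iff_ge ⟨hψ, hψ'⟩ ⟨abs_nonneg _, (abs_lt.2 hφ).le⟩

lemma volume_complex_sector {r ψ : ℝ} (hr : 0 ≤ r) (hψ : 0 ≤ ψ) (hψ' : ψ ≤ Real.pi) :
    volume {z : ℂ | ‖z‖ < r ∧ ‖z‖ * Real.cos ψ < z.re} = ENNReal.ofReal (r ^ 2 * ψ) := by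
  rw [volume_eq_of_polar (I := Ioo (-ψ) ψ) (r := r) _ measurableSet_Ioo _ hr, Real.volume_Ioo,
    ← ENNReal.ofReal_mul (by positivity)]
  · congr 1; ring
  · rintro ρ φ hρ hφ
    obtain ⟨h1, h2⟩ := polarCoord_symm_norm_re (φ := φ) hρ
    rw [mem_ofPred_eq, h1, h2, mul_lt_mul_iff_right₀ hρ, cos_lt_cos_iff_abs_lt hψ hψ' hφ, abs_lt]
    rfl
  · exact ((isOpen_lt continuous_norm continuous_const).inter
      (isOpen_lt (by fun_prop) Complex.continuous_re)).measurableSet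
  · exact Ioo_subset_Ioo (by linarith) hψ'

lemma volume_complex_closed_sector {r ψ : ℝ} (hr : 0 ≤ r) (hψ : 0 ≤ ψ) (hψ' : ψ < Real.pi) :
    volume {z : ℂ | ‖z‖ < r ∧ ‖z‖ * Real.cos ψ ≤ z.re} = ENNReal.ofReal (r ^ 2 * ψ) := by
  rw [volume_eq_of_polar (I := Icc (-ψ) ψ) (r := r) _ measurableSet_Icc _ hr, Real.volume_Icc,
    ← ENNReal.ofReal_mul (by positivity)]
  · congr 1; ring
  · rintro ρ φ hρ hφ
    obtain ⟨h1, h2⟩ := polarCoord_symm_norm_re (φ := φ) hρ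
    rw [mem_ofPred_eq, h1, h2, mul_le_mul_iff_right₀ hρ, cos_le_cos_iff_abs_le hψ hψ'.le hφ, abs_le]
    rfl
  · exact (isOpen_lt continuous_norm continuous_const).measurableSet.inter
      (isClosed_le (by fun_prop) Complex.continuous_re).measurableSet
  · exact Icc_subset_Ioo (by linarith) hψ'

/-- The open isosceles triangle with apex `0`, height `d` and half-angle `θ`. -/
lemma volume_complex_triangle {d θ : ℝ} (hd : 0 ≤ d) (hθ : 0 ≤ Real.tan θ) :
    volume {z : ℂ | z.re ∈ Ioo 0 d ∧ |z.im| < z.re * Real.tan θ} =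
      ENNReal.ofReal (d ^ 2 * Real.tan θ) := by
  have h0 : {z : ℂ | z.re ∈ Ioo 0 d ∧ |z.im| < z.re * Real.tan θ} =
      Complex.measurableEquivRealProd ⁻¹'
        (regionBetween (fun x => -(x * Real.tan θ)) (fun x => x * Real.tan θ) (Ioo 0 d)) := by
    ext z
    simp [regionBetween, Complex.measurableEquivRealProd, abs_lt]
  have hint : ∀ c : ℝ, IntegrableOn (fun x : ℝ => c * x) (Ioo 0 d) := fun c =>
    ((continuous_const.mul continuous_id).integrableOn_Icc (a := 0) (b := d)).mono_set
      Ioo_subset_Icc_self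
  rw [h0, Complex.volume_preserving_equiv_real_prod.measure_preimage
    (measurableSet_regionBetween (by fun_prop) (by fun_prop)
      measurableSet_Ioo).nullMeasurableSet, Measure.volume_eq_prod,
    volume_regionBetween_eq_integral _ _ measurableSet_Ioo]
  · congr 1
    rw [← integral_Ioc_eq_integral_Ioo, ← intervalIntegral.integral_of_le hd]
    simp only [Pi.sub_apply, sub_neg_eq_add, ← two_mul, intervalIntegral.integral_const_mul,
      intervalIntegral.integral_mul_const, integral_id]
    ring
  · intro x hx
    have := mul_nonneg hx.1.le hθ
    simpa using this
  · refine (hint (-Real.tan θ)).congr_fun (fun x _ => by ring) measurableSet_Ioo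
  · refine (hint (Real.tan θ)).congr_fun (fun x _ => by ring) measurableSet_Ioo

/-- The segment lies in the closed sector of half-angle `θ` minus the triangle `T` spanned by the
centre and the chord. -/
lemma volume_complex_cap_le {r θ : ℝ} (hr : 0 ≤ r) (hθ : 0 ≤ θ) (hθ' : θ < Real.pi / 2) :
    volume {z : ℂ | ‖z‖ < r ∧ r * Real.cos θ ≤ z.re} ≤
      ENNReal.ofReal (r ^ 2 * (θ - Real.sin θ * Real.cos θ)) := by
  have hc : 0 < Real.cos θ := Real.cos_pos_of_mem_Ioo ⟨by linarith, hθ'⟩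
  have ht : 0 ≤ Real.tan θ := Real.tan_nonneg_of_nonneg_of_le_pi_div_two hθ hθ'.le
  set T := {z : ℂ | z.re ∈ Ioo 0 (r * Real.cos θ) ∧ |z.im| < z.re * Real.tan θ} with hT
  have hTv := volume_complex_triangle (θ := θ) (mul_nonneg hr hc.le) ht
  have hTsub : T ⊆ {z : ℂ | ‖z‖ < r ∧ ‖z‖ * Real.cos θ ≤ z.re} := by
    rintro z ⟨⟨hz1, hz2⟩, hz3⟩
    have h1 : ‖z‖ * Real.cos θ ≤ z.re := by
      have h2 : z.im ^ 2 ≤ (z.re * Real.tan θ) ^ 2 := by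
        rw [← sq_abs z.im]; gcongr
      have h3 : (‖z‖ * Real.cos θ) ^ 2 ≤ z.re ^ 2 := by
        have h4 : ‖z‖ ^ 2 = z.re ^ 2 + z.im ^ 2 := by
          rw [← Complex.normSq_eq_norm_sq, Complex.normSq_apply]; ring
        rw [Real.tan_eq_sin_div_cos] at h2
        have h5 : (z.re * (Real.sin θ / Real.cos θ)) ^ 2 * Real.cos θ ^ 2
            = z.re ^ 2 * Real.sin θ ^ 2 := by field_simp
        rw [mul_pow, h4]
        have h6 := mul_le_mul_of_nonneg_right h2 (sq_nonneg (Real.cos θ))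
        rw [h5] at h6
        have h7 := Real.sin_sq_add_cos_sq θ
        nlinarith
      exact abs_le_of_sq_le_sq' h3 hz1.le |>.2
    exact ⟨lt_of_mul_lt_mul_right (h1.trans_lt hz2) hc.le, h1⟩
  have hTm : MeasurableSet T := by
    refine (Complex.measurable_re measurableSet_Ioo).inter (measurableSet_lt
      (f := fun z : ℂ => |z.im|) (g := fun z : ℂ => z.re * Real.tan θ) ?_ ?_)
    · exact (continuous_abs.comp Complex.continuous_im).measurable
    · exact (Complex.continuous_re.mul continuous_const).measurable
  calc volume {z : ℂ | ‖z‖ < r ∧ r * Real.cos θ ≤ z.re}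
      ≤ volume ({z : ℂ | ‖z‖ < r ∧ ‖z‖ * Real.cos θ ≤ z.re} \ T) := by
        refine measure_mono ?_
        rintro z ⟨hz1, hz2⟩
        refine ⟨⟨hz1, le_trans (by gcongr) hz2⟩, fun hz => ?_⟩
        exact absurd hz.1.2 (not_lt.2 hz2)
    _ = ENNReal.ofReal (r ^ 2 * (θ - Real.sin θ * Real.cos θ)) := by
        rw [measure_sdiff hTsub hTm.nullMeasurableSet (by rw [hTv]; exact ENNReal.ofReal_ne_top),
          volume_complex_closed_sector hr hθ (by linarith), hTv,
          ← ENNReal.ofReal_sub _ (by positivity)]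
        congr 1
        rw [Real.tan_eq_sin_div_cos]
        field_simp

lemma volume_sector (u : Plane) (hu : ‖u‖ = 1) {r ψ : ℝ} (hr : 0 ≤ r) (hψ : 0 ≤ ψ)
    (hψ' : ψ ≤ Real.pi) :
    volume {q : Plane | ‖q‖ < r ∧ ‖q‖ * Real.cos ψ < inner ℝ q u} =
      ENNReal.ofReal (r ^ 2 * ψ) := by
  obtain ⟨L, hL⟩ := exists_isometry_re_eq_inner u hu
  rw [← volume_complex_sector hr hψ hψ',
    ← L.measurePreserving.measure_preimage_equiv (f := L.toMeasurableEquiv)]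
  congr 1
  ext z
  simp [hL]

lemma volume_cap_le (u : Plane) (hu : ‖u‖ = 1) {r θ : ℝ} (hr : 0 ≤ r) (hθ : 0 ≤ θ)
    (hθ' : θ < Real.pi / 2) :
    volume {q : Plane | ‖q‖ < r ∧ r * Real.cos θ ≤ inner ℝ q u} ≤
      ENNReal.ofReal (r ^ 2 * (θ - Real.sin θ * Real.cos θ)) := by
  obtain ⟨L, hL⟩ := exists_isometry_re_eq_inner u hu
  refine le_trans (le_of_eq ?_) (volume_complex_cap_le hr hθ hθ')
  rw [← L.measurePreserving.measure_preimage_equiv (f := L.toMeasurableEquiv)]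
  congr 1
  ext z
  simp [hL]

/-! ### Constants of the hexagonal packing and segment-to-sector ratios. -/

/-- The circumradius of the equilateral triangle with side `2`, at which Voronoi cells are
truncated. -/
def cellRadius : ℝ := 2 / Real.sqrt 3

/-- The proportion of a disc that lies outside the inscribed regular hexagon of the disc. -/
def capRatio : ℝ := 1 - 9 * cellRadius / (4 * Real.pi)

lemma cellRadius_pos : 0 < cellRadius := by unfold cellRadius; positivity

lemma cellRadius_sq : cellRadius ^ 2 = 4 / 3 := by
  rw [cellRadius, div_pow, Real.sq_sqrt (by norm_num)]; norm_num

lemma sqrt_three_eq : Real.sqrt 3 = 3 / 2 * cellRadius := by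
  have h : cellRadius * Real.sqrt 3 = 2 := by rw [cellRadius]; field_simp
  have h3 : Real.sqrt 3 ^ 2 = 3 := Real.sq_sqrt (by norm_num)
  have h0 : 0 < Real.sqrt 3 := by positivity
  nlinarith

lemma sqrt_twelve_eq : Real.sqrt 12 = 3 * cellRadius := by
  rw [show (12 : ℝ) = (3 * cellRadius) ^ 2 by rw [mul_pow, cellRadius_sq]; norm_num,
    Real.sqrt_sq (by linarith [cellRadius_pos])]

lemma cellRadius_gt : 1.1547 < cellRadius := by
  nlinarith [cellRadius_sq, cellRadius_pos]

lemma cellRadius_lt : cellRadius < 1.15471 := by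
  nlinarith [cellRadius_sq, cellRadius_pos]

lemma capRatio_gt : 0.172 < capRatio := by
  have h1 := cellRadius_lt
  have h2 := Real.pi_gt_d4
  have h3 : 9 * cellRadius / (4 * Real.pi) < 0.828 := by
    rw [div_lt_iff₀ (by positivity)]; linarith
  unfold capRatio; linarith

/-- A circular segment of half-angle at most `π / 6` takes up at most the proportion `capRatio`
of its sector. -/
lemma sub_sin_mul_cos_le {θ : ℝ} (h0 : 0 ≤ θ) (h1 : θ ≤ Real.pi / 6) :
    θ - Real.sin θ * Real.cos θ ≤ capRatio * θ := by
  have hπ := Real.pi_pos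
  -- As sin θ cos θ = sin(2θ) / 2, the claim says that sin lies above its chord over [0, π/3] at the
  -- point 2θ.
  have hconc : (1 - 6 * θ / Real.pi) • Real.sin 0 + (6 * θ / Real.pi) • Real.sin (Real.pi / 3) ≤
      Real.sin ((1 - 6 * θ / Real.pi) • 0 + (6 * θ / Real.pi) • (Real.pi / 3)) :=
    strictConcaveOn_sin_Icc.concaveOn.2 ⟨le_rfl, hπ.le⟩ ⟨by positivity, by linarith⟩
      (by rw [sub_nonneg, div_le_one hπ]; linarith) (by positivity) (by ring)
  simp only [smul_eq_mul, mul_zero, Real.sin_zero, zero_add, Real.sin_pi_div_three] at hconc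
  have h2 : 6 * θ / Real.pi * (Real.pi / 3) = 2 * θ := by field_simp; ring
  rw [h2, Real.sin_two_mul, sqrt_three_eq] at hconc
  have h3 : capRatio * θ = θ - 6 * θ / Real.pi * (3 / 2 * cellRadius / 2) / 2 := by
    unfold capRatio; field_simp; ring
  rw [h3]; linarith

lemma sub_sin_mul_cos_le_cube {θ : ℝ} (h0 : 0 ≤ θ) :
    θ - Real.sin θ * Real.cos θ ≤ 2 / 3 * θ ^ 3 := by
  have h := Real.sin_ge_sub_cube (x := 2 * θ) (by positivity)
  rw [Real.sin_two_mul] at h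
  nlinarith

/-! ### Areas lost by a truncated Voronoi cell, compared with sectors. -/

/-- The part of a disc cut off by the bisector towards `v`. -/
def bisectorCap (v : Plane) : Set Plane := {q | ‖q‖ < cellRadius ∧ ‖q - v‖ ≤ ‖q‖}

/-- The sector spanned by the arc that the bisector towards `v` cuts off the circle. -/
def bisectorSector (v : Plane) : Set Plane :=
  {q | ‖q‖ < cellRadius ∧ ‖(cellRadius / ‖q‖) • q - v‖ < cellRadius}

/-- The part of the disc around `x` outside the disc with squared radius `a` around the origin. -/
def outerCap (a : ℝ) (x : Plane) : Set Plane := {q | ‖q‖ < cellRadius ∧ a ≤ ‖x + q‖ ^ 2}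

/-- The sector spanned by the arc of the circle around `x` outside the disc with squared radius `a`
around the origin. -/
def outerSector (a : ℝ) (x : Plane) : Set Plane :=
  {q | ‖q‖ < cellRadius ∧ q ≠ 0 ∧ a < ‖x + (cellRadius / ‖q‖) • q‖ ^ 2}

lemma norm_radial {q : Plane} (hq : q ≠ 0) : ‖(cellRadius / ‖q‖) • q‖ = cellRadius := by
  have h : 0 < ‖q‖ := norm_pos_iff.2 hq
  rw [norm_smul, Real.norm_of_nonneg (div_nonneg cellRadius_pos.le h.le)]
  field_simp

lemma ne_zero_of_mem_bisectorSector {v q : Plane} (hv : 2 ≤ ‖v‖) (h : q ∈ bisectorSector v) :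
    q ≠ 0 := by
  rintro rfl
  have := h.2
  simp only [smul_zero, zero_sub, norm_neg] at this
  linarith [cellRadius_lt]

lemma measurable_radial :
    Measurable (fun q : Plane => (cellRadius / ‖q‖) • q) := by fun_prop

lemma measurableSet_bisectorSector (v : Plane) : MeasurableSet (bisectorSector v) :=
  (measurableSet_lt measurable_norm measurable_const).inter
    (measurableSet_lt (measurable_radial.sub_const v).norm measurable_const)

lemma measurableSet_outerSector (a : ℝ) (x : Plane) : MeasurableSet (outerSector a x) :=
  (measurableSet_lt measurable_norm measurable_const).inter
    ((measurableSet_singleton (0 : Plane)).compl.inter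
      (measurableSet_lt measurable_const ((measurable_radial.const_add x).norm.pow_const 2)))

lemma volume_bisectorCap_le {v : Plane} (hv : 2 ≤ ‖v‖) :
    volume (bisectorCap v) ≤ ENNReal.ofReal capRatio * volume (bisectorSector v) := by
  have hr := cellRadius_pos
  have hr2 := cellRadius_sq
  have hv0 : 0 < ‖v‖ := by linarith
  have hcap : ∀ q ∈ bisectorCap v, ‖v‖ ^ 2 / 2 ≤ inner ℝ q v := by
    rintro q ⟨-, h⟩
    have h1 := norm_sub_sq_real q v
    have h2 : ‖q - v‖ ^ 2 ≤ ‖q‖ ^ 2 := by gcongr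
    linarith
  rcases le_or_gt (2 * cellRadius) ‖v‖ with hbig | hsmall
  · have : bisectorCap v = ∅ := by
      refine eq_empty_of_forall_notMem fun q hq => ?_
      have h1 := hcap q hq
      have h2 := real_inner_le_norm q v
      have h3 := hq.1
      nlinarith
    rw [this, measure_empty]; exact zero_le
  set u : Plane := ‖v‖⁻¹ • v with hu
  have hu1 : ‖u‖ = 1 := by rw [hu, norm_smul, norm_inv, norm_norm]; field_simp
  have hinner : ∀ q : Plane, inner ℝ q u = inner ℝ q v / ‖v‖ := fun q => by
    rw [hu, real_inner_smul_right]; field_simp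
  set θ := Real.arccos (‖v‖ / (2 * cellRadius)) with hθ
  have hle1 : ‖v‖ / (2 * cellRadius) ≤ 1 := by rw [div_le_one (by positivity)]; exact hsmall.le
  have hcos : Real.cos θ = ‖v‖ / (2 * cellRadius) :=
    Real.cos_arccos (by linarith [div_pos hv0 (by positivity : 0 < 2 * cellRadius)]) hle1
  have hθ0 : 0 ≤ θ := Real.arccos_nonneg _
  -- The condition 2 ≤ ‖v‖ gives cos θ ≥ 1 / r = √3 / 2.
  have hθ6 : θ ≤ Real.pi / 6 := by
    rw [← Real.arccos_cos (x := Real.pi / 6) (by positivity) (by linarith [Real.pi_pos]), hθ]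
    refine Real.arccos_le_arccos ?_
    rw [Real.cos_pi_div_six, sqrt_three_eq, le_div_iff₀ (by positivity)]
    nlinarith
  have hmul : cellRadius * Real.cos θ = ‖v‖ / 2 := by rw [hcos]; field_simp
  have h1 : volume (bisectorCap v) ≤
      ENNReal.ofReal (cellRadius ^ 2 * (θ - Real.sin θ * Real.cos θ)) := by
    refine le_trans (measure_mono ?_) (volume_cap_le u hu1 hr.le hθ0 (by linarith [Real.pi_pos]))
    intro q hq
    refine ⟨hq.1, ?_⟩
    rw [hmul, hinner, le_div_iff₀ hv0]
    linarith [hcap q hq]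
  have h2 : ENNReal.ofReal (cellRadius ^ 2 * θ) ≤ volume (bisectorSector v) := by
    rw [← volume_sector u hu1 hr.le hθ0 (by linarith [Real.pi_pos])]
    refine measure_mono ?_
    rintro q ⟨hq1, hq2⟩
    refine ⟨hq1, ?_⟩
    have hq0 : q ≠ 0 := by
      rintro rfl
      simp at hq2
    have hqp : 0 < ‖q‖ := norm_pos_iff.2 hq0
    have h3 := norm_sub_sq_real ((cellRadius / ‖q‖) • q) v
    rw [norm_radial hq0, real_inner_smul_left] at h3
    rw [hinner, lt_div_iff₀ hv0, hcos] at hq2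
    have h4 : ‖v‖ ^ 2 < 2 * (cellRadius / ‖q‖ * inner ℝ q v) := by
      have : cellRadius / ‖q‖ * (‖q‖ * (‖v‖ / (2 * cellRadius)) * ‖v‖) = ‖v‖ ^ 2 / 2 := by
        field_simp
      have h5 := mul_lt_mul_of_pos_left hq2 (div_pos hr hqp)
      linarith
    exact lt_of_pow_lt_pow_left₀ 2 hr.le (by linarith)
  refine h1.trans (le_trans ?_ (mul_le_mul_right h2 _))
  rw [← ENNReal.ofReal_mul (by linarith [capRatio_gt])]
  refine ENNReal.ofReal_le_ofReal ?_
  have := sub_sin_mul_cos_le hθ0 hθ6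
  nlinarith

/-- Expanding ‖x + q‖² with ‖q‖² ≤ 4/3 places the cap in a segment of half-angle `θ`; on the circle
‖q‖² = 4/3, the same expansion puts a sector of half-angle `ψ` inside the outer sector. The areas
then compare through `hangle`. -/
lemma volume_outerCap_le_of_angles {a b θ ψ : ℝ} {x : Plane} (hx : x ≠ 0) (hθ : 0 ≤ θ)
    (hθ' : θ < Real.pi / 2) (hψ : 0 ≤ ψ) (hψ' : ψ ≤ Real.pi / 2)
    (hcap : 2 * ‖x‖ * (cellRadius * Real.cos θ) ≤ a - ‖x‖ ^ 2 - 4 / 3)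
    (hsector : b - ‖x‖ ^ 2 - 4 / 3 ≤ 2 * ‖x‖ * (cellRadius * Real.cos ψ))
    (hangle : 2 / 3 * θ ^ 3 ≤ capRatio * ψ) :
    volume (outerCap a x) ≤ ENNReal.ofReal capRatio * volume (outerSector b x) := by
  have hr := cellRadius_pos
  have hr2 := cellRadius_sq
  have hx0 : 0 < ‖x‖ := norm_pos_iff.2 hx
  set u : Plane := ‖x‖⁻¹ • x with hu
  have hu1 : ‖u‖ = 1 := by rw [hu, norm_smul, norm_inv, norm_norm]; field_simp
  have hinner : ∀ q : Plane, inner ℝ q u = inner ℝ q x / ‖x‖ := fun q => by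
    rw [hu, real_inner_smul_right]; field_simp
  have h1 : volume (outerCap a x) ≤
      ENNReal.ofReal (cellRadius ^ 2 * (θ - Real.sin θ * Real.cos θ)) := by
    refine le_trans (measure_mono ?_) (volume_cap_le u hu1 hr.le hθ hθ')
    rintro q ⟨hq1, hq2⟩
    refine ⟨hq1, ?_⟩
    rw [hinner, le_div_iff₀ hx0]
    have h3 := norm_add_sq_real x q
    rw [real_inner_comm] at h3
    have h4 : ‖q‖ ^ 2 ≤ cellRadius ^ 2 := by gcongr
    linarith
  have h2 : ENNReal.ofReal (cellRadius ^ 2 * ψ) ≤ volume (outerSector b x) := by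
    rw [← volume_sector u hu1 hr.le hψ (by linarith [Real.pi_pos])]
    refine measure_mono ?_
    rintro q ⟨hq1, hq2⟩
    have hq0 : q ≠ 0 := by
      rintro rfl
      simp at hq2
    refine ⟨hq1, hq0, ?_⟩
    have hqp : 0 < ‖q‖ := norm_pos_iff.2 hq0
    have h3 := norm_add_sq_real x ((cellRadius / ‖q‖) • q)
    rw [norm_radial hq0, real_inner_smul_right, real_inner_comm] at h3
    rw [hinner, lt_div_iff₀ hx0] at hq2
    have h4 : cellRadius * Real.cos ψ * ‖x‖ < cellRadius / ‖q‖ * inner ℝ q x := by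
      have : cellRadius / ‖q‖ * (‖q‖ * Real.cos ψ * ‖x‖) = cellRadius * Real.cos ψ * ‖x‖ := by
        field_simp
      rw [← this]
      exact mul_lt_mul_of_pos_left hq2 (div_pos hr hqp)
    linarith
  refine h1.trans (le_trans ?_ (mul_le_mul_right h2 _))
  rw [← ENNReal.ofReal_mul (by linarith [capRatio_gt])]
  refine ENNReal.ofReal_le_ofReal ?_
  have := sub_sin_mul_cos_le_cube hθ
  nlinarith

lemma cos_le_quartic {θ : ℝ} (h0 : 0 ≤ θ) (h1 : θ ≤ 1) :
    Real.cos θ ≤ 1 - θ ^ 2 / 2 + θ ^ 4 * (5 / 96) := by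
  have := (abs_le.1 (Real.cos_bound (x := θ) (by rwa [abs_of_nonneg h0]))).2
  rw [abs_of_nonneg h0] at this
  linarith

/-- The sector may use a smaller squared radius than the cap because arcs of bisectors never go
beyond it (`disjoint_outerSector`). This gap leaves room for crude numerical estimates. -/
lemma volume_outerCap_le {x : Plane} {R : ℝ} (hR : 1 ≤ R) (hx : ‖x‖ ≤ R) :
    volume (outerCap (R ^ 2 + 2 * R + 1.1) x) ≤
      ENNReal.ofReal capRatio * volume (outerSector (R ^ 2 + R * cellRadius - 2 / 3) x) := by
  have hr := cellRadius_pos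
  have hr2 := cellRadius_sq
  have hr3 := cellRadius_lt
  have hr4 := cellRadius_gt
  have hc := capRatio_gt
  have hπ := Real.pi_gt_d4
  have ht0 := norm_nonneg x
  set t := ‖x‖ with ht
  -- `D` is a lower bound for twice the inner product of `x` with any point of the cap, so D / (2 t
  -- r) plays the role of the cosine of its half-angle.
  have hD : ∃ D, D = R ^ 2 + 2 * R + 1.1 - t ^ 2 - 4 / 3 := ⟨_, rfl⟩
  obtain ⟨D, hD⟩ := hD
  have htR : t ^ 2 ≤ R ^ 2 := by gcongr
  rcases le_or_gt (2 * t * cellRadius) D with hempty | hlt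
  · have : outerCap (R ^ 2 + 2 * R + 1.1) x = ∅ := by
      refine eq_empty_of_forall_notMem fun q hq => ?_
      have h1 := norm_add_sq_real x q
      have h2 := real_inner_le_norm x q
      have h3 := hq.1
      have h4 := hq.2
      have h5 : t * ‖q‖ ≤ t * cellRadius := by gcongr
      have h6 : ‖q‖ ^ 2 < cellRadius ^ 2 := by gcongr
      linarith
    rw [this, measure_empty]; exact zero_le
  have hx0 : x ≠ 0 := by
    rintro rfl
    rw [norm_zero] at ht
    rw [ht] at hlt hD
    nlinarith
  have c1 := cos_le_quartic (θ := 0.58) (by norm_num) (by norm_num)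
  have c2 := cos_le_quartic (θ := 0.64) (by norm_num) (by norm_num)
  have c3 := cos_le_quartic (θ := 0.72) (by norm_num) (by norm_num)
  norm_num at c1 c2 c3
  have hmul : ∀ {a b : ℝ}, a ≤ b → 2 * t * (cellRadius * a) ≤ 2 * t * (cellRadius * b) :=
    fun h => by gcongr
  -- A smaller `D` allows a wider cap but also guarantees a wider sector. The pairs (0.58, π/4),
  -- (0.64, π/3), (0.72, π/2) all satisfy 2/3 θ³ ≤ 0.172 ψ.
  rcases le_or_gt (2 * t * (cellRadius * Real.cos 0.58)) D with h1 | h1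
  · refine volume_outerCap_le_of_angles hx0 (θ := 0.58) (ψ := Real.pi / 4) (by norm_num)
      (by linarith) (by positivity) (by linarith) (by rw [← hD]; exact h1) ?_ ?_
    · have h2 : 1.4 < Real.sqrt 2 := by rw [Real.lt_sqrt] <;> norm_num
      rw [Real.cos_pi_div_four]
      have := hmul (show (0.7 : ℝ) ≤ Real.sqrt 2 / 2 by linarith)
      nlinarith
    · nlinarith
  rcases le_or_gt (2 * t * (cellRadius * Real.cos 0.64)) D with h2 | h2
  · refine volume_outerCap_le_of_angles hx0 (θ := 0.64) (ψ := Real.pi / 3) (by norm_num)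
      (by linarith) (by positivity) (by linarith) (by rw [← hD]; exact h2) ?_ ?_
    · rw [Real.cos_pi_div_three]
      have h3 := hmul (show Real.cos 0.58 ≤ 0.838 by norm_num at c1 ⊢; linarith)
      nlinarith
    · nlinarith
  · have h3 := hmul (show Real.cos 0.64 ≤ 0.804 by norm_num at c2 ⊢; linarith)
    -- Together with D ≥ 2R - 0.2334 and t ≤ R this forces R < 1.64, which makes half-angle π/2
    -- available for the sector. The same lower bound on `D`, with R ≥ 1, shows that 0.72 suffices
    -- for the cap.
    have h4 : D ≤ 1.857 * t := by nlinarith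
    have h5 := hmul (show Real.cos 0.72 ≤ 0.755 by norm_num at c3 ⊢; linarith)
    refine volume_outerCap_le_of_angles hx0 (θ := 0.72) (ψ := Real.pi / 2) (by norm_num)
      (by linarith) (by positivity) le_rfl ?_ ?_ ?_
    · rw [← hD]
      nlinarith
    · rw [Real.cos_pi_div_two]
      nlinarith
    · nlinarith

/-! ### Disjointness of the sectors and the area of a cell. -/

/-- A common direction gives a point p at distance r from 0 and less than r from `v` and `w`. For a
= p, b = p - v, c = p - w, the sum of ‖a‖², ‖b‖², ‖c‖² is below 4, while the squared differences sum
to at least 12. This contradicts ‖a + b + c‖² = 3 (sum of squares) - (sum of squared differences) ≥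
0. -/
lemma disjoint_bisectorSector {v w : Plane} (hv : 2 ≤ ‖v‖) (hw : 2 ≤ ‖w‖) (hvw : 2 ≤ ‖v - w‖) :
    Disjoint (bisectorSector v) (bisectorSector w) := by
  rw [Set.disjoint_left]
  intro q hqv hqw
  have hq0 := ne_zero_of_mem_bisectorSector hv hqv
  have h0 := norm_radial hq0
  have h1 := hqv.2
  have h2 := hqw.2
  set p : Plane := (cellRadius / ‖q‖) • q
  have hr2 := cellRadius_sq
  have e1 : ‖p - v‖ ^ 2 < 4 / 3 := by rw [← hr2]; gcongr
  have e2 : ‖p - w‖ ^ 2 < 4 / 3 := by rw [← hr2]; gcongr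
  have e3 : ‖p‖ ^ 2 = 4 / 3 := by rw [h0, hr2]
  have f1 : 2 ^ 2 ≤ ‖v‖ ^ 2 := by gcongr
  have f2 : 2 ^ 2 ≤ ‖w‖ ^ 2 := by gcongr
  have f3 : 2 ^ 2 ≤ ‖v - w‖ ^ 2 := by gcongr
  have g1 := norm_sub_sq_real p (p - v)
  have g2 := norm_sub_sq_real p (p - w)
  have g3 := norm_sub_sq_real (p - w) (p - v)
  have g4 := norm_add_sq_real (p + (p - v)) (p - w)
  have g5 := norm_add_sq_real p (p - v)
  rw [inner_add_left] at g4
  rw [sub_sub_cancel] at g1 g2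
  rw [sub_sub_sub_cancel_left, real_inner_comm] at g3
  have g6 := sq_nonneg ‖p + (p - v) + (p - w)‖
  linarith

/-- Split x + p at the midpoint x + v/2. The parallelogram law gives ‖x + v/2‖² ≤ R² - 1 and ‖p -
v/2‖² ≤ 1/3 = (r/2)², so ‖x + p‖² ≤ R² + R r - 2/3. -/
lemma disjoint_outerSector {x v : Plane} {R : ℝ} (hR : 1 ≤ R) (hx : ‖x‖ ≤ R) (hxv : ‖x + v‖ ≤ R)
    (hv : 2 ≤ ‖v‖) :
    Disjoint (bisectorSector v) (outerSector (R ^ 2 + R * cellRadius - 2 / 3) x) := by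
  rw [Set.disjoint_left]
  intro q hqv hqw
  have hq0 := ne_zero_of_mem_bisectorSector hv hqv
  have h0 := norm_radial hq0
  have h1 := hqv.2
  have h2 := hqw.2.2
  set p : Plane := (cellRadius / ‖q‖) • q
  have hr2 := cellRadius_sq
  have hr := cellRadius_pos
  have e1 : ‖p - v‖ ^ 2 < 4 / 3 := by rw [← hr2]; gcongr
  have e3 : ‖p‖ ^ 2 = 4 / 3 := by rw [h0, hr2]
  have f1 : 2 ^ 2 ≤ ‖v‖ ^ 2 := by gcongr
  have f2 : ‖x‖ ^ 2 ≤ R ^ 2 := by gcongr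
  have f3 : ‖x + v‖ ^ 2 ≤ R ^ 2 := by gcongr
  have hm : ‖x + (2⁻¹ : ℝ) • v‖ ^ 2 ≤ R ^ 2 - 1 := by
    have := norm_add_sq_real x ((2⁻¹ : ℝ) • v)
    have := norm_add_sq_real x v
    simp only [norm_smul, real_inner_smul_right] at *
    norm_num at *
    nlinarith
  have hz : ‖p - (2⁻¹ : ℝ) • v‖ ^ 2 ≤ 1 / 3 := by
    have := norm_sub_sq_real p ((2⁻¹ : ℝ) • v)
    have := norm_sub_sq_real p v
    simp only [norm_smul, real_inner_smul_right] at *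
    norm_num at *
    nlinarith
  have hm' : ‖x + (2⁻¹ : ℝ) • v‖ ≤ R :=
    abs_le_of_sq_le_sq' (by linarith) (by linarith) |>.2
  have hz' : ‖p - (2⁻¹ : ℝ) • v‖ ≤ cellRadius / 2 :=
    abs_le_of_sq_le_sq' (by rw [div_pow, hr2]; linarith) (by linarith) |>.2
  have hsum : x + p = (x + (2⁻¹ : ℝ) • v) + (p - (2⁻¹ : ℝ) • v) := by abel
  have h3 := norm_add_sq_real (x + (2⁻¹ : ℝ) • v) (p - (2⁻¹ : ℝ) • v)
  rw [← hsum] at h3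
  have h4 := real_inner_le_norm (x + (2⁻¹ : ℝ) • v) (p - (2⁻¹ : ℝ) • v)
  have h5 : ‖x + (2⁻¹ : ℝ) • v‖ * ‖p - (2⁻¹ : ℝ) • v‖ ≤ R * (cellRadius / 2) := by gcongr
  linarith

/-- Voronoi cells truncated at `cellRadius` and by a slightly larger ball are at least as large as
the regular hexagon circumscribed about the unit disc. -/
lemma volume_cell_ge (V : Finset Plane) (x : Plane) {R : ℝ} (hR : 1 ≤ R) (hx : ‖x‖ ≤ R)
    (hV : ∀ v ∈ V, 2 ≤ ‖v‖) (hVV : ∀ v ∈ V, ∀ w ∈ V, v ≠ w → 2 ≤ ‖v - w‖)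
    (hxV : ∀ v ∈ V, ‖x + v‖ ≤ R) :
    ENNReal.ofReal (3 * cellRadius) ≤
      volume {q : Plane | ‖q‖ < cellRadius ∧ (∀ v ∈ V, ‖q‖ < ‖q - v‖) ∧
        ‖x + q‖ ^ 2 < R ^ 2 + 2 * R + 1.1} := by
  set A := R ^ 2 + 2 * R + 1.1
  set C := {q : Plane | ‖q‖ < cellRadius ∧ (∀ v ∈ V, ‖q‖ < ‖q - v‖) ∧ ‖x + q‖ ^ 2 < A} with hC
  set W := outerSector (R ^ 2 + R * cellRadius - 2 / 3) x
  have hr := cellRadius_pos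
  have hc := capRatio_gt
  have hball : volume (Metric.ball (0 : Plane) cellRadius) =
      ENNReal.ofReal (4 / 3 * Real.pi) := by
    rw [EuclideanSpace.volume_ball_fin_two, ← ENNReal.ofReal_pow hr.le, cellRadius_sq,
      ENNReal.ofReal_mul (by norm_num)]
  have hcover : Metric.ball (0 : Plane) cellRadius ⊆
      C ∪ ((⋃ v ∈ V, bisectorCap v) ∪ outerCap A x) := by
    intro q hq
    rw [mem_ball_zero_iff] at hq
    by_cases h1 : ∀ v ∈ V, ‖q‖ < ‖q - v‖
    · by_cases h2 : ‖x + q‖ ^ 2 < A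
      · exact Or.inl ⟨hq, h1, h2⟩
      · exact Or.inr (Or.inr ⟨hq, not_lt.1 h2⟩)
    · push Not at h1
      obtain ⟨v, hv, h1⟩ := h1
      exact Or.inr (Or.inl (mem_biUnion (x := v) hv ⟨hq, h1⟩))
  have hsectors : ∑ v ∈ V, volume (bisectorSector v) + volume W ≤
      volume (Metric.ball (0 : Plane) cellRadius) := by
    rw [← measure_biUnion_finset (fun v hv w hw hvw =>
        disjoint_bisectorSector (hV v hv) (hV w hw) (hVV v hv w hw hvw))
      (fun v _ => measurableSet_bisectorSector v),
      ← measure_union _ (measurableSet_outerSector _ _)]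
    · refine measure_mono (union_subset (iUnion₂_subset fun v hv q hq => ?_) fun q hq => ?_)
      · exact mem_ball_zero_iff.2 hq.1
      · exact mem_ball_zero_iff.2 hq.1
    · rw [disjoint_iUnion₂_left]
      exact fun v hv => disjoint_outerSector hR hx (hxV v hv) (hV v hv)
  have hmain : ENNReal.ofReal (4 / 3 * Real.pi) ≤
      volume C + ENNReal.ofReal (capRatio * (4 / 3 * Real.pi)) := by
    rw [ENNReal.ofReal_mul (p := capRatio) (by linarith), ← hball]
    calc volume (Metric.ball (0 : Plane) cellRadius)
        ≤ volume C + (∑ v ∈ V, volume (bisectorCap v) + volume (outerCap A x)) := by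
          refine (measure_mono hcover).trans ((measure_union_le _ _).trans ?_)
          gcongr
          refine (measure_union_le _ _).trans ?_
          gcongr
          exact measure_biUnion_finset_le _ _
      _ ≤ volume C + ENNReal.ofReal capRatio * (∑ v ∈ V, volume (bisectorSector v) + volume W) := by
          rw [mul_add, Finset.mul_sum]
          gcongr with v hv
          · exact volume_bisectorCap_le (hV v hv)
          · exact volume_outerCap_le hR hx
      _ ≤ _ := by gcongr
  -- The fraction 1 - `capRatio` of the disc area 4π/3 is the area of the inscribed hexagon.
  have hval : 3 * cellRadius = 4 / 3 * Real.pi - capRatio * (4 / 3 * Real.pi) := by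
    have := Real.pi_pos
    unfold capRatio; field_simp; ring
  rw [hval, ENNReal.ofReal_sub _ (by positivity)]
  exact tsub_le_iff_right.2 hmain

/-! ### The packing bound. -/

lemma volume_lt_sq_norm {A : ℝ} (hA : 0 ≤ A) :
    volume {p : Plane | ‖p‖ ^ 2 < A} = ENNReal.ofReal (A * Real.pi) := by
  have h : {p : Plane | ‖p‖ ^ 2 < A} = Metric.ball 0 (Real.sqrt A) := by
    ext p
    rw [mem_ball_zero_iff, Real.lt_sqrt (norm_nonneg p)]
    rfl
  rw [h, EuclideanSpace.volume_ball_fin_two, ← ENNReal.ofReal_pow (Real.sqrt_nonneg A),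
    Real.sq_sqrt hA, ENNReal.ofReal_mul hA]

/-- A packing inequality of Thue type for points with mutual distances at least `2`. -/
lemma card_mul_le_of_two_le (s : Finset Plane) {R : ℝ} (hR : 1 ≤ R) (hs : ∀ x ∈ s, ‖x‖ ≤ R)
    (hsep : ∀ x ∈ s, ∀ y ∈ s, x ≠ y → 2 ≤ ‖x - y‖) :
    s.card * (3 * cellRadius) ≤ Real.pi * (R ^ 2 + 2 * R + 1.1) := by
  classical
  have hr := cellRadius_pos
  set A := R ^ 2 + 2 * R + 1.1 with hA
  have hA0 : 0 ≤ A := by nlinarith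
  let C : Plane → Set Plane := fun x =>
    {p | ‖p - x‖ < cellRadius ∧ (∀ y ∈ s, y ≠ x → ‖p - x‖ < ‖p - y‖) ∧ ‖p‖ ^ 2 < A}
  have hCm : ∀ x, MeasurableSet (C x) := fun x => by
    have h1 : C x = ({p | ‖p - x‖ < cellRadius} ∩
        ⋂ y ∈ s, ⋂ (_ : y ≠ x), {p | ‖p - x‖ < ‖p - y‖}) ∩ {p | ‖p‖ ^ 2 < A} := by
      ext p
      simp [C, and_assoc]
    rw [h1]
    refine MeasurableSet.inter (MeasurableSet.inter ?_ ?_) ?_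
    · exact measurableSet_lt (by fun_prop) measurable_const
    · refine s.measurableSet_biInter fun y _ => MeasurableSet.iInter fun _ => ?_
      exact measurableSet_lt (by fun_prop) (by fun_prop)
    · exact measurableSet_lt (by fun_prop) measurable_const
  have hCv : ∀ x ∈ s, ENNReal.ofReal (3 * cellRadius) ≤ volume (C x) := by
    intro x hx
    have hV : ∀ v, v ∈ (s.erase x).image (fun y => y - x) ↔ ∃ y ∈ s, y ≠ x ∧ y - x = v := by
      intro v; simp only [Finset.mem_image, Finset.mem_erase]; tauto
    refine (volume_cell_ge ((s.erase x).image fun y => y - x) x hR (hs x hx) ?_ ?_ ?_).trans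
      (le_of_eq ?_)
    · intro v hv
      obtain ⟨y, hy, hyx, rfl⟩ := (hV v).1 hv
      exact hsep y hy x hx hyx
    · intro v hv w hw hvw
      obtain ⟨y, hy, hyx, rfl⟩ := (hV v).1 hv
      obtain ⟨z, hz, hzx, rfl⟩ := (hV w).1 hw
      rw [sub_sub_sub_cancel_right]
      exact hsep y hy z hz fun h => hvw (by rw [h])
    · intro v hv
      obtain ⟨y, hy, hyx, rfl⟩ := (hV v).1 hv
      rw [add_sub_cancel]
      exact hs y hy
    · rw [← (measurePreserving_sub_right volume x).measure_preimage_equiv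
        (f := MeasurableEquiv.subRight x)]
      have hsub : ∀ p, MeasurableEquiv.subRight x p = p - x := fun _ => rfl
      congr 1
      ext p
      simp only [C, mem_preimage, mem_ofPred_eq, hsub, add_sub_cancel, hV, hA]
      refine and_congr_right fun _ => and_congr_left fun _ => ⟨fun h y hy hyx => ?_, ?_⟩
      · simpa using h _ ⟨y, hy, hyx, rfl⟩
      · rintro h _ ⟨y, hy, hyx, rfl⟩
        simpa using h y hy hyx
  have hdisj : (s : Set Plane).PairwiseDisjoint C := by
    intro x hx y hy hxy
    refine Set.disjoint_left.2 fun p hpx hpy => ?_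
    exact lt_asymm (hpx.2.1 y hy hxy.symm) (hpy.2.1 x hx hxy)
  have hsum : (s.card : ENNReal) * ENNReal.ofReal (3 * cellRadius) ≤
      ENNReal.ofReal (A * Real.pi) := by
    rw [← volume_lt_sq_norm hA0, ← nsmul_eq_mul]
    calc s.card • ENNReal.ofReal (3 * cellRadius) ≤ ∑ x ∈ s, volume (C x) :=
          Finset.card_nsmul_le_sum _ _ _ hCv
      _ = volume (⋃ x ∈ s, C x) := (measure_biUnion_finset hdisj fun x _ => hCm x).symm
      _ ≤ _ := measure_mono (iUnion₂_subset fun x _ p hp => hp.2.2)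
  rw [← ENNReal.ofReal_natCast, ← ENNReal.ofReal_mul (by positivity),
    ENNReal.ofReal_le_ofReal_iff (by positivity)] at hsum
  linarith

lemma rhoH_nonneg {H : ℝ} (hH : 0 < H) : 0 ≤ rhoH H := by
  have := Real.pi_pos
  unfold rhoH; positivity

lemma nuH_pos {H : ℝ} (hH : 0 < H) : 0 < nuH H := by
  have := Real.pi_pos
  unfold nuH; positivity

/-- A closed ball of radius `R` contains at most `1 + ρ_H R + ν_H R²` points with mutual distances
at least `2 H`. -/
theorem card_le_of_separated (s : Finset Plane) {H R : ℝ} (hH : 0 < H) (hR : 0 ≤ R)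
    (hs : ∀ x ∈ s, ‖x‖ ≤ R) (hsep : ∀ x ∈ s, ∀ y ∈ s, x ≠ y → 2 * H ≤ ‖x - y‖) :
    (s.card : ℝ) ≤ 1 + rhoH H * R + nuH H * R ^ 2 := by
  classical
  rcases le_or_gt s.card 1 with h1 | h1
  · have h2 : (s.card : ℝ) ≤ 1 := by exact_mod_cast h1
    have h3 := mul_nonneg (rhoH_nonneg hH) hR
    have h4 := mul_nonneg (nuH_pos hH).le (sq_nonneg R)
    linarith
  obtain ⟨a, ha, b, hb, hab⟩ := Finset.one_lt_card.1 h1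
  -- Two separated points in the ball force R ≥ H, so the rescaled radius is at least 1.
  have hHR : H ≤ R := by
    have h2 := hsep a ha b hb hab
    have h3 := norm_sub_le a b
    linarith [hs a ha, hs b hb]
  have hinj : Function.Injective (fun x : Plane => H⁻¹ • x) :=
    smul_right_injective _ (inv_ne_zero hH.ne')
  have h2 := card_mul_le_of_two_le (s.image fun x => H⁻¹ • x) (R := R / H)
    ((one_le_div hH).2 hHR) ?_ ?_
  · rw [Finset.card_image_of_injective _ hinj] at h2
    have hr := cellRadius_pos
    have h3 : (s.card : ℝ) ≤ Real.pi * ((R / H) ^ 2 + 2 * (R / H) + 1.1) / (3 * cellRadius) := by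
      rwa [le_div_iff₀ (by positivity)]
    -- This is where the slack 1.1 is paid for: 1.1 π / √12 ≈ 0.998.
    have h4 : 1.1 * Real.pi / (3 * cellRadius) ≤ 1 := by
      rw [div_le_one (by positivity)]
      linarith [Real.pi_lt_d4, cellRadius_gt]
    have h5 : Real.pi * ((R / H) ^ 2 + 2 * (R / H) + 1.1) / (3 * cellRadius) =
        1.1 * Real.pi / (3 * cellRadius) + rhoH H * R + nuH H * R ^ 2 := by
      rw [rhoH, nuH, sqrt_twelve_eq]
      field_simp
      ring
    linarith
  · intro x hx
    obtain ⟨y, hy, rfl⟩ := Finset.mem_image.1 hx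
    rw [norm_smul, norm_inv, Real.norm_of_nonneg hH.le, inv_mul_eq_div]
    have := hs y hy
    gcongr
  · intro x hx y hy hxy
    obtain ⟨x, hx', rfl⟩ := Finset.mem_image.1 hx
    obtain ⟨y, hy', rfl⟩ := Finset.mem_image.1 hy
    rw [← smul_sub, norm_smul, norm_inv, Real.norm_of_nonneg hH.le, inv_mul_eq_div, le_div_iff₀ hH]
    exact hsep x hx' y hy' fun h => hxy (by rw [h])

/-! ### From counts to sums of non-increasing functions. -/

/-- Summation by parts: if at most `1 + ρ t + ν t²` of the points have norm at most `t`, sums of a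
non-increasing function of the norm are bounded by the corresponding integral. -/
theorem sum_le_of_card_le {E : Type*} [NormedAddCommGroup E] {ρ ν : ℝ} (hρ : 0 ≤ ρ) (hν : 0 < ν)
    {ℓ : ℝ → ℝ} (hℓ0 : ∀ t, 0 ≤ t → 0 ≤ ℓ t) (hℓ : AntitoneOn ℓ (Ici 0)) (s : Finset E)
    (hs : ∀ t, 0 ≤ t → ((s.filter fun x => ‖x‖ ≤ t).card : ℝ) ≤ 1 + ρ * t + ν * t ^ 2)
    {R : ℝ} (hR : 0 ≤ R) (hsR : ∀ x ∈ s, ‖x‖ ≤ R) :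
    ∑ x ∈ s, ℓ ‖x‖ ≤ ℓ 0 + ρ * (∫ r in (0 : ℝ)..R, ℓ r) + 2 * ν * (∫ r in (0 : ℝ)..R, r * ℓ r) := by
  classical
  have hint : ∀ a b : ℝ, 0 ≤ a → a ≤ b → IntervalIntegrable ℓ volume a b := fun a b ha hab =>
    (hℓ.mono (by rw [uIcc_of_le hab]; exact fun x hx => ha.trans hx.1)).intervalIntegrable
  have hint' : ∀ a b : ℝ, 0 ≤ a → a ≤ b →
      IntervalIntegrable (fun t => (ρ + 2 * ν * t) * ℓ t) volume a b := fun a b ha hab =>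
    (hint a b ha hab).continuousOn_mul (by fun_prop)
  -- the bound up to the radius `b` at which `1 + ρ b + ν b²` reaches the number of points
  have key : ∀ s : Finset E,
      (∀ t, 0 ≤ t → ((s.filter fun x => ‖x‖ ≤ t).card : ℝ) ≤ 1 + ρ * t + ν * t ^ 2) →
      ∀ b, 0 ≤ b → 1 + ρ * b + ν * b ^ 2 = s.card →
      ∑ x ∈ s, ℓ ‖x‖ ≤ ℓ 0 + ∫ t in (0 : ℝ)..b, (ρ + 2 * ν * t) * ℓ t := by
    intro s
    induction s using Finset.induction_on_max_value (fun x : E => ‖x‖) with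
    | empty =>
      intro _ b hb hbc
      rw [Finset.card_empty, Nat.cast_zero] at hbc
      nlinarith [mul_nonneg hρ hb, mul_nonneg hν.le (sq_nonneg b)]
    | insert a s ha hmax ih =>
      intro hs b hb hbc
      rw [Finset.card_insert_of_notMem ha, Nat.cast_add, Nat.cast_one] at hbc
      -- Otherwise the closed ball of radius ‖a‖ < b would hold all the points, more than 1 + ρ‖a‖ +
      -- ν‖a‖² allows.
      have hba : b ≤ ‖a‖ := by
        by_contra! hlt
        have h1 := hs ‖a‖ (norm_nonneg a)
        rw [Finset.filter_true_of_mem, Finset.card_insert_of_notMem ha, Nat.cast_add,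
          Nat.cast_one] at h1
        · have h2 : ‖a‖ ^ 2 < b ^ 2 := by gcongr
          nlinarith
        · intro x hx
          rcases Finset.mem_insert.1 hx with rfl | hx
          · exact le_rfl
          · exact hmax x hx
      have hab : ℓ ‖a‖ ≤ ℓ b := hℓ hb (norm_nonneg a) hba
      rw [Finset.sum_insert ha]
      rcases Nat.eq_zero_or_pos s.card with h0 | h0
      · have hb0 : b = 0 := by
          rw [h0, Nat.cast_zero] at hbc
          have h1 := mul_nonneg hρ hb
          have h2 : ν * b ^ 2 ≤ 0 := by linarith
          have h3 : b ^ 2 ≤ 0 := by nlinarith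
          nlinarith
        rw [Finset.card_eq_zero.1 h0, Finset.sum_empty, hb0, intervalIntegral.integral_same,
          add_zero, add_zero, ← hb0]
        exact hab
      · have h1 : (1 : ℝ) ≤ s.card := by exact_mod_cast h0
        obtain ⟨b', ⟨hb'0, hb'b⟩, hb'⟩ := intermediate_value_Icc hb
          (f := fun t => 1 + ρ * t + ν * t ^ 2) (by fun_prop)
          (show (s.card : ℝ) ∈ Icc _ _ from ⟨by simpa using h1, by simp only [hbc]; linarith⟩)
        have h2 := ih (fun t ht => le_trans (by
          gcongr
          exact Finset.subset_insert a s) (hs t ht)) b' hb'0 hb'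
        -- The density ρ + 2νt has mass exactly 1 on [b', b], since the counting bound rises by one
        -- there, and ℓ ≥ ℓ(b) on this interval.
        have h3 : ℓ b ≤ ∫ t in b'..b, (ρ + 2 * ν * t) * ℓ t := by
          calc ℓ b = ∫ t in b'..b, (ρ + 2 * ν * t) * ℓ b := by
                rw [intervalIntegral.integral_mul_const, intervalIntegral.integral_add (by simp)
                  (Continuous.intervalIntegrable (by fun_prop) _ _),
                  intervalIntegral.integral_const_mul, integral_id, intervalIntegral.integral_const,
                  smul_eq_mul]
                simp only at hb'
                have h4 : (b - b') * ρ + 2 * ν * ((b ^ 2 - b' ^ 2) / 2) = 1 := by linarith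
                rw [h4, one_mul]
            _ ≤ _ := by
                refine intervalIntegral.integral_mono_on hb'b
                  (Continuous.intervalIntegrable (by fun_prop) _ _) (hint' b' b hb'0 hb'b) ?_
                intro t ht
                have ht0 : 0 ≤ t := hb'0.trans ht.1
                have := hℓ ht0 hb ht.2
                have : 0 ≤ ρ + 2 * ν * t := by positivity
                gcongr
        rw [← intervalIntegral.integral_add_adjacent_intervals (hint' 0 b' le_rfl hb'0)
          (hint' b' b hb'0 hb'b)]
        linarith
  have hsplit : ∫ t in (0 : ℝ)..R, (ρ + 2 * ν * t) * ℓ t =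
      ρ * (∫ r in (0 : ℝ)..R, ℓ r) + 2 * ν * (∫ r in (0 : ℝ)..R, r * ℓ r) := by
    rw [← intervalIntegral.integral_const_mul, ← intervalIntegral.integral_const_mul,
      ← intervalIntegral.integral_add ((hint 0 R le_rfl hR).const_mul ρ)
        (((hint 0 R le_rfl hR).continuousOn_mul (by fun_prop)).const_mul _)]
    refine intervalIntegral.integral_congr fun t _ => ?_
    ring
  have hnn : ∀ t, 0 ≤ t → 0 ≤ (ρ + 2 * ν * t) * ℓ t := fun t ht =>
    mul_nonneg (by positivity) (hℓ0 t ht)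
  rw [add_assoc, ← hsplit]
  rcases s.eq_empty_or_nonempty with rfl | hne
  · rw [Finset.sum_empty]
    exact add_nonneg (hℓ0 0 le_rfl)
      (intervalIntegral.integral_nonneg hR fun t ht => hnn t ht.1)
  · have h1 : (1 : ℝ) ≤ s.card := by exact_mod_cast hne.card_pos
    have h2 := hs R hR
    rw [Finset.filter_true_of_mem hsR] at h2
    -- The count at radius `R` gives b ≤ R, and the integral over [b, R] is non-negative.
    obtain ⟨b, ⟨hb0, hbR⟩, hb⟩ := intermediate_value_Icc hR
      (f := fun t => 1 + ρ * t + ν * t ^ 2) (by fun_prop)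
      (show (s.card : ℝ) ∈ Icc _ _ from ⟨by simpa using h1, h2⟩)
    refine (key s hs b hb0 hb).trans ?_
    rw [← intervalIntegral.integral_add_adjacent_intervals (hint' 0 b le_rfl hb0)
      (hint' b R hb0 hbR)]
    have := intervalIntegral.integral_nonneg (μ := volume) hbR fun t ht => hnn t (hb0.trans ht.1)
    linarith

/-! ### Stationarity of the mark classes. -/

lemma pointMeasure_apply {X : Type*} [MeasurableSpace X] (S : Set X) {B : Set X}
    (hB : MeasurableSet B) : pointMeasure S B = ∑' x : S, B.indicator 1 (x : X) := by
  rw [pointMeasure, Measure.sum_apply _ hB]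
  exact tsum_congr fun x => Measure.dirac_apply' _ hB

lemma pointMeasure_image_apply {X Y : Type*} [MeasurableSpace Y] (S : Set X) {f : X → Y}
    (hf : InjOn f S) {B : Set Y} (hB : MeasurableSet B) :
    pointMeasure (f '' S) B = ∑' x : S, B.indicator 1 (f x) := by
  rw [pointMeasure_apply _ hB, tsum_image (g := f) (fun y => B.indicator 1 y) hf]

/-- The point measure on the plane formed by the points with mark `i`. -/
def classMeasure {K : ℕ} (i : Fin K) (μ : Measure (Plane × Fin K)) : Measure Plane :=
  (μ.restrict (univ ×ˢ {i})).map Prod.fst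

lemma measurable_classMeasure {K : ℕ} (i : Fin K) : Measurable (classMeasure i) := by
  refine (Measure.measurable_map _ measurable_fst).comp ?_
  refine Measure.measurable_of_measurable_coe _ fun B hB => ?_
  simp only [Measure.restrict_apply hB]
  exact Measure.measurable_coe (hB.inter (MeasurableSet.univ.prod (measurableSet_singleton i)))

/-- Each class is one fixed measurable image of the marked configuration. Taking `f` to be the
identity or a translation lets the invariance of the marked law pass to the class. -/
lemma pointMeasure_eq_classMeasure {K : ℕ} (S : Set Plane) (M : Plane → Fin K) (i : Fin K)
    {f : Plane → Plane} (hf : Function.Injective f) :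
    pointMeasure (f '' {x ∈ S | M x = i}) =
      classMeasure i (pointMeasure ((fun p : Plane × Fin K => (f p.1, p.2)) '' markedPoints S M)) := by
  refine Measure.ext fun B hB => ?_
  have hinj : InjOn (fun x => (f x, M x)) S := fun _ _ _ _ h => hf (congrArg Prod.fst h)
  rw [classMeasure, Measure.map_apply measurable_fst hB,
    Measure.restrict_apply (measurable_fst hB), markedPoints, image_image,
    pointMeasure_image_apply S hinj ((measurable_fst hB).inter
      (MeasurableSet.univ.prod (measurableSet_singleton i))),
    pointMeasure_image_apply _ hf.injOn hB, tsum_subtype {x ∈ S | M x = i}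
      (fun x => B.indicator (1 : Plane → ENNReal) (f x)),
    tsum_subtype S (fun x => (Prod.fst ⁻¹' B ∩ univ ×ˢ {i}).indicator
      (1 : Plane × Fin K → ENNReal) (f x, M x))]
  refine tsum_congr fun x => ?_
  by_cases h1 : x ∈ S <;> by_cases h2 : M x = i <;> by_cases h3 : f x ∈ B <;>
    simp [indicator, h1, h2, h3]

lemma pointMeasure_translate {K : ℕ} (S : Set Plane) (M : Plane → Fin K) (t : Plane) :
    pointMeasure ((fun p : Plane × Fin K => (p.1 + t, p.2)) '' markedPoints S M) =
      (pointMeasure (markedPoints S M)).map (fun p : Plane × Fin K => (p.1 + t, p.2)) := by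
  have hm : Measurable (fun p : Plane × Fin K => (p.1 + t, p.2)) := by fun_prop
  refine Measure.ext fun B hB => ?_
  have hinj : Function.Injective (fun p : Plane × Fin K => (p.1 + t, p.2)) := by
    rintro ⟨x, i⟩ ⟨y, j⟩ h
    simpa using h
  rw [Measure.map_apply hm hB, pointMeasure_image_apply _ hinj.injOn hB,
    pointMeasure_apply _ (hm hB)]
  rfl

/-- The points of a stationary marked point process with a given mark form a stationary point
process. -/
theorem IsStationaryMarking.markClass {Ω : Type*} [MeasurableSpace Ω] {P : Measure Ω}
    {Φ : Ω → Set Plane} {K : ℕ} {M : Ω → Plane → Fin K} (hM : IsStationaryMarking P Φ M)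
    (hΦ : IsPointProcess Φ) (i : Fin K) : IsStationaryPointProcess P (markClass Φ M i) := by
  have hid : ∀ ω, pointMeasure (Hardcore.markClass Φ M i ω) =
      classMeasure i (pointMeasure (markedPoints (Φ ω) (M ω))) := fun ω => by
    have := pointMeasure_eq_classMeasure (Φ ω) (M ω) i Function.injective_id
    simpa [Hardcore.markClass] using this
  have hmeas := measurable_classMeasure i
  refine ⟨⟨fun ω B hB => (hΦ.locallyFinite ω B hB).subset
    (inter_subset_inter_left _ fun x hx => hx.1), ?_⟩, fun t => ?_⟩
  · simp only [hid]
    exact hmeas.comp hM.measurable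
  · have ht : ∀ ω, pointMeasure ((fun x => x + t) '' Hardcore.markClass Φ M i ω) =
        classMeasure i (pointMeasure
          ((fun p : Plane × Fin K => (p.1 + t, p.2)) '' markedPoints (Φ ω) (M ω))) := fun ω =>
      pointMeasure_eq_classMeasure (Φ ω) (M ω) i (add_left_injective t)
    have htm : Measurable (fun ω => pointMeasure
        ((fun p : Plane × Fin K => (p.1 + t, p.2)) '' markedPoints (Φ ω) (M ω))) := by
      simp only [pointMeasure_translate]
      exact (Measure.measurable_map _ (by fun_prop)).comp hM.measurable
    simp only [hid, ht]
    have := congrArg (Measure.map (classMeasure i)) (hM.stationary t)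
    rwa [Measure.map_map hmeas htm, Measure.map_map hmeas hM.measurable] at this

/-- The ball bound for a locally finite set of points with mutual distances at least `2 H`. -/
lemma ncard_inter_ball_le {S : Set Plane} {H R : ℝ} (hH : 0 < H) (hR : 0 ≤ R)
    (hfin : (S ∩ Metric.ball 0 R).Finite)
    (hsep : ∀ x ∈ S, ∀ y ∈ S, x ≠ y → 2 * H ≤ ‖x - y‖) :
    ((S ∩ Metric.ball (0 : Plane) R).ncard : ℝ) ≤ 1 + rhoH H * R + nuH H * R ^ 2 := by
  rw [ncard_eq_toFinset_card _ hfin]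
  refine card_le_of_separated _ hH hR (fun x hx => ?_) fun x hx y hy => ?_
  · rw [Finite.mem_toFinset] at hx
    exact (mem_ball_zero_iff.1 hx.2).le
  · rw [Finite.mem_toFinset] at hx hy
    exact hsep x hx.1 y hy.1

/-- The shot-noise bound for a locally finite set of points with mutual distances at least
`2 H`. -/
lemma finsum_inter_ball_le {S : Set Plane} {H R : ℝ} (hH : 0 < H) (hR : 0 ≤ R)
    (hfin : (S ∩ Metric.ball 0 R).Finite)
    (hsep : ∀ x ∈ S, ∀ y ∈ S, x ≠ y → 2 * H ≤ ‖x - y‖)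
    {ℓ : ℝ → ℝ} (hℓ0 : ∀ t, 0 ≤ t → 0 ≤ ℓ t) (hℓ : AntitoneOn ℓ (Ici 0)) :
    ∑ᶠ x ∈ S ∩ Metric.ball (0 : Plane) R, ℓ ‖x‖ ≤
      ℓ 0 + rhoH H * (∫ r in (0 : ℝ)..R, ℓ r) + 2 * nuH H * (∫ r in (0 : ℝ)..R, r * ℓ r) := by
  rw [finsum_mem_eq_finite_toFinset_sum _ hfin]
  refine sum_le_of_card_le (rhoH_nonneg hH) (nuH_pos hH) hℓ0 hℓ _ (fun t ht => ?_) hR fun x hx => ?_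
  · refine card_le_of_separated _ hH ht (fun x hx => (Finset.mem_filter.1 hx).2) ?_
    intro x hx y hy
    have hx := (Finite.mem_toFinset _).1 (Finset.mem_filter.1 hx).1
    have hy := (Finite.mem_toFinset _).1 (Finset.mem_filter.1 hy).1
    exact hsep x hx.1 y hy.1
  · rw [Finite.mem_toFinset] at hx
    exact (mem_ball_zero_iff.1 hx.2).le

end Hardcore

end

theorem lemma1 {Ω : Type*} [MeasurableSpace Ω] (P : Measure Ω) [IsProbabilityMeasure P]
    (Φ : Ω → Set Hardcore.Plane) (K : ℕ) (hK : 0 < K) (H : ℝ) (hH : 0 < H)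
    (hΦ : Hardcore.IsHardcoreRegulated P Φ K H) :
    ∃ M : Ω → Hardcore.Plane → Fin K, Hardcore.IsStationaryMarking P Φ M ∧
      ∀ i : Fin K,
        Hardcore.IsStronglyBallRegulated P (Hardcore.markClass Φ M i)
          1 (Hardcore.rhoH H) (Hardcore.nuH H) ∧
        ∀ ℓ : ℝ → ℝ, (∀ r, 0 ≤ r → 0 ≤ ℓ r) → BddAbove (ℓ '' Ici 0) → AntitoneOn ℓ (Ici 0) →
          ∀ R : ℝ, 0 < R →
            ∀ᵐ ω ∂P,
              ∑ᶠ x ∈ Hardcore.markClass Φ M i ω ∩ Metric.ball (0 : Hardcore.Plane) R, ℓ ‖x‖ ≤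
                ℓ 0 + Hardcore.rhoH H * (∫ r in (0 : ℝ)..R, ℓ r) +
                  2 * Hardcore.nuH H * (∫ r in (0 : ℝ)..R, r * ℓ r) := by
  obtain ⟨M, hM, hsep⟩ := hΦ.exists_marking
  refine ⟨M, hM, fun i => ?_⟩
  have hstat := hM.markClass hΦ.toIsPointProcess i
  have hfin : ∀ ω R, (Hardcore.markClass Φ M i ω ∩ Metric.ball 0 R).Finite := fun ω R =>
    hstat.locallyFinite ω _ Metric.isBounded_ball
  -- This single almost sure event serves every radius and every ℓ.
  have hclass : ∀ᵐ ω ∂P, ∀ x ∈ Hardcore.markClass Φ M i ω, ∀ y ∈ Hardcore.markClass Φ M i ω,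
      x ≠ y → 2 * H ≤ ‖x - y‖ :=
    hsep.mono fun ω h x hx y hy hxy => h x hx.1 y hy.1 hxy (hx.2.trans hy.2.symm)
  refine ⟨⟨hstat, one_pos, Hardcore.nuH_pos hH, fun R hR => hclass.mono fun ω h =>
    Hardcore.ncard_inter_ball_le hH hR (hfin ω R) h⟩, ?_⟩
  intro ℓ hℓ0 _ hℓ R hR
  exact hclass.mono fun ω h => Hardcore.finsum_inter_ball_le hH hR.le (hfin ω R) h hℓ0 hℓ
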